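/- Let $t$ be a transcendental real number, and let $\mathbb Q(t)\subset\mathbb R$ be the subfield of $\mathbb R$ generated by $t$. Let $G_t$ be the subgroup of $\operatorname{GL}_2(\mathbb Q(t))$ consisting of the matrices $\begin{pmatrix} a & b\\ 0 & 1\end{pmatrix}$ with $a,b\in\mathbb Q(t)$ and $a>0$. Let $\mathfrak F$ be the class of finite groups. For ordinals $\alpha$ define classes ${\bf H}_\alpha\mathfrak F$ of discrete groups as follows: ${\bf H}_0\mathfrak F=\mathfrak F$; a group $G$ belongs to ${\bf H}_{\alpha+1}\mathfrak F$ if there is a finite dimensional contractible $G$-complex (that is, $G$-CW-complex) all of whose point stabilizers belong to ${\bf H}_\alpha\mathfrak F$; and ${\bf H}_\alpha\mathfrak F=\bigcup_{\beta<\alpha}{\bf H}_\beta\mathfrak F$ if $\alpha$ is a non-zero limit ordinal. Here a $G$-complex is a CW complex with an action of $G$ by homeomorphisms under which each group element maps open cells onto open cells, and every group element that maps an open cell onto itself fixes that cell pointwise. Then $G_t$ belongs to ${\bf H}_3\mathfrak F$. -/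

import Mathlib

open Topology Set

universe u

/-- For a discrete group `G`, a `G`-complex (`G`-CW-complex) is a CW complex `X` on which `G` acts by
homeomorphisms so that every group element maps open cells onto open cells, and so that an element
mapping an open cell onto itself fixes it pointwise. Equivalently, `X` is built by attaching
equivariant cells `G/H × Dⁿ`. The given data are the CW structure on the Hausdorff space `X` and the
action. -/
structure IsGComplex (G : Type u) [Group G] (X : Type u) [TopologicalSpace X] [T2Space X]
    [CWComplex (univ : Set X)] [MulAction G X] : Prop where
  continuous_smul : ∀ g : G, Continuous fun x : X => g • x
  exists_image_openCell : ∀ (g : G) (n : ℕ) (e : RelCWComplex.cell (univ : Set X) n),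
    ∃ e' : RelCWComplex.cell (univ : Set X) n,
      (fun x : X => g • x) '' RelCWComplex.openCell n e = RelCWComplex.openCell n e'
  smul_eq_of_image_openCell : ∀ (g : G) (n : ℕ) (e : RelCWComplex.cell (univ : Set X) n),
    (fun x : X => g • x) '' RelCWComplex.openCell n e = RelCWComplex.openCell n e →
      ∀ x ∈ RelCWComplex.openCell n e, g • x = x

/-- `G` admits a finite dimensional contractible `G`-complex all of whose stabilizers belong to the
class of groups `𝔛`. -/
def ActsWithStabilizersIn (𝔛 : (G : Type u) → [Group G] → Prop) (G : Type u) [Group G] : Prop :=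
  ∃ (X : Type u) (_ : TopologicalSpace X) (_ : T2Space X) (_ : CWComplex (univ : Set X))
    (_ : MulAction G X),
    IsGComplex G X ∧ ContractibleSpace X ∧
      RelCWComplex.FiniteDimensional (univ : Set X) ∧ ∀ x : X, 𝔛 (MulAction.stabilizer G x)

/-- Kropholler's hierarchy `H_α 𝔛`, by transfinite recursion on the ordinal `α`: `H_0 𝔛 = 𝔛`; a group
is in `H_{α+1} 𝔛` if it admits a finite dimensional contractible complex with stabilizers in
`H_α 𝔛`; at limit ordinals one takes the union of the earlier classes. -/
noncomputable def HClass (𝔛 : (G : Type u) → [Group G] → Prop) (α : Ordinal.{u}) :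
    (G : Type u) → [Group G] → Prop :=
  Ordinal.limitRecOn (motive := fun _ => (G : Type u) → [Group G] → Prop) α
    𝔛
    (fun _ ih G _ => ActsWithStabilizersIn ih G)
    (fun α _ ih G _ => ∃ (β : Ordinal.{u}) (hβ : β < α), ih β hβ G)

theorem HClass_zero (𝔛 : (G : Type u) → [Group G] → Prop) (G : Type u) [Group G] :
    HClass 𝔛 0 G ↔ 𝔛 G := by
  unfold HClass
  rw [Ordinal.limitRecOn_zero]

theorem HClass_add_one (𝔛 : (G : Type u) → [Group G] → Prop) (α : Ordinal.{u})
    (G : Type u) [Group G] :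
    HClass 𝔛 (α + 1) G ↔ ActsWithStabilizersIn (HClass 𝔛 α) G := by
  unfold HClass
  rw [Ordinal.limitRecOn_add_one]

theorem HClass_limit (𝔛 : (G : Type u) → [Group G] → Prop) (α : Ordinal.{u})
    (hα : Order.IsSuccLimit α) (G : Type u) [Group G] :
    HClass 𝔛 α G ↔ ∃ β : Ordinal.{u}, β < α ∧ HClass 𝔛 β G := by
  unfold HClass
  rw [Ordinal.limitRecOn_limit (h := hα)]
  simp only [exists_prop]

/-- The class `𝔉` of finite groups. -/
def FiniteGroups (G : Type u) [Group G] : Prop := Finite G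

/-- The group `G_t`: the subgroup of `GL₂(ℚ(t))` of all matrices `(a b; 0 1)` with `a > 0`, where
`ℚ(t)` is the subfield of `ℝ` generated by `t`. -/
def affineGroup (t : ℝ) : Subgroup (GL (Fin 2) (IntermediateField.adjoin ℚ {t})) where
  carrier := {M | (0 : ℝ) < (M 0 0 : IntermediateField.adjoin ℚ {t}) ∧ M 1 0 = 0 ∧ M 1 1 = 1}
  one_mem' := by simp
  mul_mem' := by
    rintro A B ⟨hA, hA0, hA1⟩ ⟨hB, hB0, hB1⟩
    refine ⟨?_, ?_, ?_⟩ <;>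
      simp [Matrix.mul_apply, Fin.sum_univ_two, hA0, hB0, hA1, hB1, mul_pos hA hB]
  inv_mem' := by
    rintro A ⟨hA, hA0, hA1⟩
    have hd : (A : Matrix (Fin 2) (Fin 2) (IntermediateField.adjoin ℚ {t})).det = A 0 0 := by
      rw [Matrix.det_fin_two, hA0, hA1]; ring
    have h0 : (A 0 0 : IntermediateField.adjoin ℚ {t}) ≠ 0 := by
      intro h; rw [h] at hA; simp at hA
    refine ⟨?_, ?_, ?_⟩ <;>
      simp [Matrix.inv_def, Matrix.adjugate_fin_two, hd, hA0, hA1, h0, hA]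

/-! Each of the three levels of the hierarchy is gained from an action on a finite product of trees
in which every tree has a fixed end. Such a product is a finite dimensional cube complex. It is
contractible, because flowing towards the ends merges any point with the rays from a base vertex.
The end also orients the edges, so a cell mapped to itself is fixed pointwise. Hence only
simultaneous vertex stabilizers matter (`actsWithStabilizersIn_of_trees`).

The field ℚ(t) is the fraction field of the factorial ring ℤ[X], and the group acts on it by affine
maps z ↦ az + b. For nonzero D in ℤ[X], consider the maps with a a unit and b integral at every
prime not dividing D. As ℤ[X] is countable, the group is an increasing union of such subgroups, so
it acts on a coset tree with stabilizers embedding in them (`AffineAction.HClass_three`).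

Such a subgroup acts on the trees of balls for the finitely many primes dividing D and for the
degree (`AffineAction.HClass_two_of_integral`). In a stabilizer, a is a unit at all primes, so a =
±1, and a = 1 by positivity. Then b has a bounded power of D as denominator and a numerator of
bounded degree, so the stabilizer embeds in some ℤⁿ, which acts freely on a product of lines
(`HClass_one_freeAbelian`). Working over ℤ[X] rather than ℚ[X] is what makes these stabilizers
finitely generated. -/

/-! ### Trees with a fixed end -/

/-- A combinatorial tree with a distinguished end: every vertex has a unique parent, its neighbour
in the direction of the end, and any two vertices have a common ancestor. -/
structure EndedTree : Type (u + 1) where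
  Vertex : Type u
  parent : Vertex → Vertex
  height : Vertex → ℤ
  height_parent : ∀ x, height (parent x) = height x + 1
  exists_iterate_eq : ∀ x y, ∃ m n : ℕ, parent^[m] x = parent^[n] y
  nonempty : Nonempty Vertex

namespace EndedTree

variable (T : EndedTree.{u})

theorem height_iterate (n : ℕ) (x : T.Vertex) : T.height (T.parent^[n] x) = T.height x + n := by
  induction n with
  | zero => simp
  | succ n ih => rw [Function.iterate_succ_apply', T.height_parent, ih]; push_cast; ring

theorem iterate_injective (x : T.Vertex) : Function.Injective fun n : ℕ => T.parent^[n] x := by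
  intro m n h
  have := congrArg T.height h
  simp only [T.height_iterate] at this
  omega

theorem parent_ne (x : T.Vertex) : T.parent x ≠ x := by
  intro h
  have := congrArg T.height h
  rw [T.height_parent] at this
  omega

end EndedTree

/-! ### Points, flow and barycentric coordinates of a product of trees -/

/-- The set underlying the product of the geometric realizations of the trees `T i`: a point of the
`i`-th factor is given by a vertex and a distance in `[0, 1)` travelled towards its parent. -/
@[ext]
structure Realization {ι : Type u} (T : ι → EndedTree.{u}) : Type u where
  vertex : ∀ i, (T i).Vertex
  offset : ι → ℝ
  offset_nonneg : ∀ i, 0 ≤ offset i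
  offset_lt_one : ∀ i, offset i < 1

namespace Realization

variable {ι : Type u} {T : ι → EndedTree.{u}}

/-- Start at the vertex `x` and travel the distance `r i` towards the end in the `i`-th tree. -/
noncomputable def flow (x : ∀ i, (T i).Vertex) (r : ι → ℝ) : Realization T where
  vertex i := (T i).parent^[⌊r i⌋₊] (x i)
  offset i := Int.fract (r i)
  offset_nonneg _ := Int.fract_nonneg _
  offset_lt_one _ := Int.fract_lt_one _

theorem flow_of_lt_one {x : ∀ i, (T i).Vertex} {r : ι → ℝ} (h0 : ∀ i, 0 ≤ r i)
    (h1 : ∀ i, r i < 1) : flow x r = ⟨x, r, h0, h1⟩ := by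
  ext i
  · have : ⌊r i⌋₊ = 0 := Nat.floor_eq_zero.2 (h1 i)
    simp [flow, this]
  · exact Int.fract_eq_self.2 ⟨h0 i, h1 i⟩

@[simp]
theorem flow_vertex_offset (ξ : Realization T) : flow ξ.vertex ξ.offset = ξ :=
  flow_of_lt_one ξ.offset_nonneg ξ.offset_lt_one

theorem flow_iterate (x : ∀ i, (T i).Vertex) (n : ι → ℕ) {r : ι → ℝ} (h0 : ∀ i, 0 ≤ r i) :
    flow (fun i => (T i).parent^[n i] (x i)) r = flow x fun i => r i + n i := by
  ext i
  · simp only [flow, Nat.floor_add_natCast (h0 i), Function.iterate_add_apply]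
  · simp [flow]

/-- Travel times add. This replaces the jumping base vertex of a point by the fixed corner of a cube
containing it. -/
theorem flow_flow (x : ∀ i, (T i).Vertex) {r s : ι → ℝ} (hr : ∀ i, 0 ≤ r i) (hs : ∀ i, 0 ≤ s i) :
    flow (flow x r).vertex (fun i => (flow x r).offset i + s i) = flow x fun i => r i + s i := by
  refine (flow_iterate x (fun i => ⌊r i⌋₊)
    fun i => add_nonneg ((flow x r).offset_nonneg i) (hs i)).trans ?_
  congr 1
  funext i
  simp only [flow]
  rw [natCast_floor_eq_intCast_floor (hr i)]
  linarith [Int.fract_add_floor (r i)]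

open Classical in
/-- The barycentric coordinate of a point of the `i`-th tree with respect to the vertex `v`. -/
noncomputable def coord (i : ι) (v : (T i).Vertex) (ξ : Realization T) : ℝ :=
  if ξ.vertex i = v then 1 - ξ.offset i else
    if (T i).parent (ξ.vertex i) = v then ξ.offset i else 0

theorem coord_vertex (ξ : Realization T) (i : ι) : coord i (ξ.vertex i) ξ = 1 - ξ.offset i := by
  simp [coord]

theorem coord_parent (ξ : Realization T) (i : ι) :
    coord i ((T i).parent (ξ.vertex i)) ξ = ξ.offset i := by
  simp [coord, ((T i).parent_ne _).symm]

/-- The coordinate of a point at its own vertex is positive, so in each factor the two vertices are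
equal or each is the parent of the other; heights exclude the latter. -/
theorem eq_of_coord_eq {ξ η : Realization T} (h : ∀ i v, coord i v ξ = coord i v η) : ξ = η := by
  have key : ∀ {ξ η : Realization T}, (∀ i v, coord i v ξ = coord i v η) → ∀ i,
      η.vertex i = ξ.vertex i ∨ (T i).parent (η.vertex i) = ξ.vertex i := by
    intro ξ η h i
    by_contra! hne
    have := h i (ξ.vertex i)
    rw [coord_vertex, coord, if_neg hne.1, if_neg hne.2] at this
    linarith [ξ.offset_lt_one i]
  have hv : ∀ i, ξ.vertex i = η.vertex i := by
    intro i
    rcases key h i with h1 | h1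
    · exact h1.symm
    rcases key (fun i v => (h i v).symm) i with h2 | h2
    · exact h2
    have h1 := congrArg (T i).height h1
    have h2 := congrArg (T i).height h2
    rw [(T i).height_parent] at h1 h2
    omega
  ext i
  · exact hv i
  · have := h i (ξ.vertex i)
    rw [coord_vertex, hv i, coord_vertex] at this
    linarith

open Classical in
theorem coord_flow (x : ∀ i, (T i).Vertex) (r : ι → ℝ) (i : ι) (v : (T i).Vertex) :
    coord i v (flow x r) =
      if (T i).parent^[⌊r i⌋₊] (x i) = v then 1 - Int.fract (r i) else
        if (T i).parent^[⌊r i⌋₊ + 1] (x i) = v then Int.fract (r i) else 0 := by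
  simp only [Function.iterate_succ_apply']
  rfl

/-- The tent function shows continuity in the travel time, although the floor and the fractional
part jump. -/
theorem coord_flow_iterate (x : ∀ i, (T i).Vertex) {r : ι → ℝ} (i : ι) (h0 : 0 ≤ r i) (n : ℕ) :
    coord i ((T i).parent^[n] (x i)) (flow x r) = max 0 (1 - |r i - n|) := by
  have hf : Int.fract (r i) = r i - ⌊r i⌋₊ := by
    rw [natCast_floor_eq_intCast_floor h0]; rfl
  have h1 := Nat.floor_le h0
  have h2 := Nat.lt_floor_add_one (r i)
  rw [coord_flow, hf]
  by_cases hn : n = ⌊r i⌋₊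
  · subst hn
    rw [if_pos rfl, abs_of_nonneg (by linarith), max_eq_right (by linarith)]
  · rw [if_neg fun h => hn ((T i).iterate_injective (x i) h).symm]
    by_cases hn' : n = ⌊r i⌋₊ + 1
    · subst hn'
      push_cast
      rw [if_pos rfl, abs_of_nonpos (by linarith), max_eq_right (by linarith)]
      ring
    · rw [if_neg fun h => hn' ((T i).iterate_injective (x i) h).symm, max_eq_left]
      rcases lt_or_gt_of_ne hn with h | h
      · have : (n : ℝ) + 1 ≤ ⌊r i⌋₊ := by exact_mod_cast h
        linarith [le_abs_self (r i - n)]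
      · have : (⌊r i⌋₊ : ℝ) + 1 + 1 ≤ n := by
          have : ⌊r i⌋₊ + 1 + 1 ≤ n := by omega
          exact_mod_cast this
        linarith [neg_le_abs (r i - n)]

theorem coord_flow_eq_zero (x : ∀ i, (T i).Vertex) (r : ι → ℝ) (i : ι) (v : (T i).Vertex)
    (h : ∀ n, (T i).parent^[n] (x i) ≠ v) : coord i v (flow x r) = 0 := by
  rw [coord_flow, if_neg (h _), if_neg (h _)]

theorem continuous_coord_flow {Y : Type*} [TopologicalSpace Y] (x : ∀ i, (T i).Vertex)
    {ρ : Y → ι → ℝ} (hρ : Continuous ρ) (h0 : ∀ y i, 0 ≤ ρ y i) (i : ι) (v : (T i).Vertex) :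
    Continuous fun y => coord i v (flow x (ρ y)) := by
  by_cases h : ∃ n, (T i).parent^[n] (x i) = v
  · obtain ⟨n, rfl⟩ := h
    simp only [coord_flow_iterate x i (h0 _ i)]
    fun_prop
  · push Not at h
    simp only [coord_flow_eq_zero x _ i v h]
    exact continuous_const

/-! ### The weak topology -/

/-- The cube spanned by `x` and its parents. -/
noncomputable def cube (x : ∀ i, (T i).Vertex) (q : ι → unitInterval) : Realization T :=
  flow x fun i => q i

/-- The weak topology with respect to the closed cubes. -/
noncomputable instance : TopologicalSpace (Realization T) :=
  ⨆ x, TopologicalSpace.coinduced (cube x) inferInstance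

theorem continuous_cube (x : ∀ i, (T i).Vertex) : Continuous (cube x) :=
  continuous_iff_coinduced_le.2 (le_iSup (fun x => TopologicalSpace.coinduced (cube x) _) x)

theorem continuous_iff_cube {Z : Type*} [TopologicalSpace Z] {f : Realization T → Z} :
    Continuous f ↔ ∀ x, Continuous fun q => f (cube x q) := by
  simp only [continuous_iSup_dom, continuous_coinduced_dom, Function.comp_def]

theorem isClosed_iff_cube {A : Set (Realization T)} :
    IsClosed A ↔ ∀ x, IsClosed (cube x ⁻¹' A) := by
  simp only [isClosed_iSup_iff, isClosed_coinduced]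

theorem continuous_coord (i : ι) (v : (T i).Vertex) : Continuous (coord i v) :=
  continuous_iff_cube.2 fun x =>
    continuous_coord_flow x (by fun_prop) (fun q i => (q i).2.1) i v

instance : T2Space (Realization T) := by
  have hc : Continuous fun (ξ : Realization T) i v => coord i v ξ :=
    continuous_pi fun i => continuous_pi fun v => continuous_coord i v
  exact T2Space.of_injective_continuous
    (fun ξ η h => eq_of_coord_eq fun i v => congrFun (congrFun h i) v) hc

/-- A map into finitely many cubes is continuous once its barycentric coordinates are. -/
theorem continuous_of_continuous_coord {Y : Type*} [TopologicalSpace Y] {f : Y → Realization T}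
    (hf : ∀ i v, Continuous fun y => coord i v (f y)) {F : Set (∀ i, (T i).Vertex)} (hF : F.Finite)
    (hfF : ∀ y, ∃ x ∈ F, f y ∈ range (cube x)) : Continuous f := by
  let K : Set (Realization T) := ⋃ x ∈ F, range (cube x)
  have hK : CompactSpace K := isCompact_iff_compactSpace.1 <|
    hF.isCompact_biUnion fun x _ => isCompact_range (continuous_cube x)
  let E : K → ∀ i, (T i).Vertex → ℝ := fun ξ i v => coord i v ξ
  have hE : Continuous E := continuous_pi fun i => continuous_pi fun v =>
    (continuous_coord i v).comp continuous_subtype_val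
  -- A continuous injection from a compact space to a Hausdorff space is a closed embedding, so on
  -- finitely many cubes the coordinates induce the weak topology.
  have hEi : Function.Injective E := fun ξ η h =>
    Subtype.ext (eq_of_coord_eq fun i v => congrFun (congrFun h i) v)
  let g : Y → K := fun y => ⟨f y, by simpa [K] using hfF y⟩
  have hg : Continuous g := (hE.isClosedEmbedding hEi).isInducing.continuous_iff.2 <|
    continuous_pi fun i => continuous_pi fun v => hf i v
  exact continuous_subtype_val.comp hg

/-- The bound leaves finitely many integer parts, hence finitely many cubes, and there coordinates
decide continuity. -/
theorem continuous_flow [Finite ι] {Y : Type*} [TopologicalSpace Y] (x : ∀ i, (T i).Vertex)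
    {ρ : Y → ι → ℝ} (hρ : Continuous ρ) (h0 : ∀ y i, 0 ≤ ρ y i) {N : ℕ} (hN : ∀ y i, ρ y i ≤ N) :
    Continuous fun y => flow x (ρ y) := by
  refine continuous_of_continuous_coord (continuous_coord_flow x hρ h0)
    (F := range fun (n : ι → Fin (N + 1)) i => (T i).parent^[n i] (x i)) (finite_range _) ?_
  intro y
  refine ⟨_, ⟨fun i => ⟨⌊ρ y i⌋₊, Nat.lt_succ_of_le (Nat.floor_le_of_le (hN y i))⟩, rfl⟩,
    fun i => ⟨Int.fract (ρ y i), Int.fract_nonneg _, (Int.fract_lt_one _).le⟩, ?_⟩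
  exact flow_vertex_offset (flow x (ρ y))

end Realization

/-! ### Contractibility -/

namespace Realization

variable {ι : Type u} {T : ι → EndedTree.{u}}

theorem isQuotientMap_sigma_cube :
    IsQuotientMap fun p : Σ _ : ∀ i, (T i).Vertex, ι → unitInterval => cube p.1 p.2 := by
  rw [isQuotientMap_iff_isClosed]
  refine ⟨fun ξ => ⟨⟨ξ.vertex, fun i => ⟨ξ.offset i, ξ.offset_nonneg i, (ξ.offset_lt_one i).le⟩⟩,
    flow_vertex_offset ξ⟩, fun A => ?_⟩
  rw [isClosed_iff_cube, isClosed_sigma_iff]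
  rfl

/-- A quotient map stays a quotient map after a product with a locally compact space. With the unit
interval as that space, homotopies can be checked cube by cube. -/
theorem continuous_prod_of_cube {Y Z : Type*} [TopologicalSpace Y] [TopologicalSpace Z]
    [LocallyCompactSpace Y] {f : Realization T × Y → Z}
    (hf : ∀ x, Continuous fun p : (ι → unitInterval) × Y => f (cube x p.1, p.2)) :
    Continuous f := by
  refine isQuotientMap_sigma_cube.continuous_lift_prod_left ?_
  have h : Continuous fun p : (Σ _ : ∀ i, (T i).Vertex, (ι → unitInterval) × Y) =>
      f (cube p.1 p.2.1, p.2.2) := continuous_sigma hf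
  exact h.comp (Homeomorph.sigmaProdDistrib).continuous

/-- The affine extension along edges of a function on vertices. -/
noncomputable def extend (m : ∀ i, (T i).Vertex → ℕ) (ξ : Realization T) (i : ι) : ℝ :=
  (1 - ξ.offset i) * m i (ξ.vertex i) + ξ.offset i * m i ((T i).parent (ξ.vertex i))

theorem extend_nonneg (m : ∀ i, (T i).Vertex → ℕ) (ξ : Realization T) (i : ι) :
    0 ≤ extend m ξ i := by
  have := ξ.offset_nonneg i
  have := ξ.offset_lt_one i
  have : 0 ≤ 1 - ξ.offset i := by linarith
  unfold extend
  positivity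

theorem extend_cube (m : ∀ i, (T i).Vertex → ℕ) (x : ∀ i, (T i).Vertex) (q : ι → unitInterval)
    (i : ι) : extend m (cube x q) i = (1 - q i) * m i (x i) + q i * m i ((T i).parent (x i)) := by
  rcases (q i).2.2.eq_or_lt with h | h
  · simp [extend, cube, flow, h]
  · have h0 : ⌊(q i : ℝ)⌋₊ = 0 := Nat.floor_eq_zero.2 h
    simp [extend, cube, flow, h0, Int.fract_eq_self.2 ⟨(q i).2.1, h⟩]

theorem extend_cube_le (m : ∀ i, (T i).Vertex → ℕ) (x : ∀ i, (T i).Vertex) (q : ι → unitInterval)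
    (i : ι) : extend m (cube x q) i ≤ m i (x i) + m i ((T i).parent (x i)) := by
  rw [extend_cube]
  have h0 := (q i).2.1
  have h1 := (q i).2.2
  have ha : (0 : ℝ) ≤ m i (x i) := Nat.cast_nonneg _
  have hb : (0 : ℝ) ≤ m i ((T i).parent (x i)) := Nat.cast_nonneg _
  nlinarith [mul_nonneg h0 ha, mul_nonneg (sub_nonneg.2 h1) hb]

theorem continuous_extend_cube (m : ∀ i, (T i).Vertex → ℕ) (x : ∀ i, (T i).Vertex) (i : ι) :
    Continuous fun q => extend m (cube x q) i := by
  simp only [extend_cube]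
  fun_prop

theorem exists_bound [Finite ι] {x : ∀ i, (T i).Vertex} (m : ∀ i, (T i).Vertex → ℕ) :
    ∃ N : ℕ, ∀ i (q : ι → unitInterval), extend m (cube x q) i ≤ N := by
  cases nonempty_fintype ι
  refine ⟨∑ i, (m i (x i) + m i ((T i).parent (x i))), fun i q => (extend_cube_le m x q i).trans ?_⟩
  exact_mod_cast Finset.single_le_sum
    (f := fun i => m i (x i) + m i ((T i).parent (x i))) (fun _ _ => Nat.zero_le _)
    (Finset.mem_univ i)

/-- Flow every point up by the given height function. -/
noncomputable def flowUp (m : ∀ i, (T i).Vertex → ℕ) (s : ℝ) (ξ : Realization T) :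
    Realization T :=
  flow ξ.vertex fun i => ξ.offset i + s * extend m ξ i

theorem continuous_flowUp [Finite ι] (m : ∀ i, (T i).Vertex → ℕ) :
    Continuous fun p : Realization T × unitInterval => flowUp m p.2 p.1 := by
  refine continuous_prod_of_cube fun x => ?_
  obtain ⟨N, hN⟩ := exists_bound (x := x) m
  have hnn : ∀ (p : (ι → unitInterval) × unitInterval) i, 0 ≤ p.2 * extend m (cube x p.1) i :=
    fun p i => mul_nonneg p.2.2.1 (extend_nonneg m _ i)
  have heq : ∀ p : (ι → unitInterval) × unitInterval, flowUp m p.2 (cube x p.1) =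
      flow x fun i => p.1 i + p.2 * extend m (cube x p.1) i :=
    fun p => flow_flow x (fun i => (p.1 i).2.1) (hnn p)
  simp only [heq]
  refine continuous_flow x (N := 1 + N) ?_ (fun p i => add_nonneg (p.1 i).2.1 (hnn p i)) ?_
  · refine continuous_pi fun i => ?_
    have := (continuous_extend_cube m x i).comp
      (continuous_fst : Continuous fun p : (ι → unitInterval) × unitInterval => p.1)
    simp only [Function.comp_def] at this
    fun_prop
  · intro p i
    have h1 := mul_le_mul p.2.2.2 (hN i p.1) (extend_nonneg m _ i) zero_le_one
    have h2 := (p.1 i).2.2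
    push_cast
    linarith

theorem continuous_flow_extend [Finite ι] (m : ∀ i, (T i).Vertex → ℕ) (b : ∀ i, (T i).Vertex) :
    Continuous fun p : Realization T × unitInterval =>
      flow b fun i => (1 - p.2 : ℝ) * extend m p.1 i := by
  refine continuous_prod_of_cube fun x => ?_
  obtain ⟨N, hN⟩ := exists_bound (x := x) m
  refine continuous_flow b (N := N) ?_
    (fun p i => mul_nonneg (sub_nonneg.2 p.2.2.2) (extend_nonneg m _ i)) ?_
  · refine continuous_pi fun i => ?_
    have := (continuous_extend_cube m x i).comp
      (continuous_fst : Continuous fun p : (ι → unitInterval) × unitInterval => p.1)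
    simp only [Function.comp_def] at this
    fun_prop
  · intro p i
    have h1 := mul_le_mul (sub_le_self (1 : ℝ) p.2.2.1) (hN i p.1) (extend_nonneg m _ i) zero_le_one
    linarith

/-- Both sides travel equally far beyond a vertex where the rays from the point and from `b` have
already merged. No minimality or compatibility of `m` and `n` is needed, since heights alone control
their difference. -/
theorem flowUp_one_eq {m n : ∀ i, (T i).Vertex → ℕ} {b : ∀ i, (T i).Vertex}
    (h : ∀ i x, (T i).parent^[m i x] x = (T i).parent^[n i x] (b i)) (ξ : Realization T) :
    flowUp m 1 ξ = flow b (extend n ξ) := by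
  have hheight : ∀ i x, (T i).height x + m i x = (T i).height (b i) + n i x := fun i x => by
    simpa only [(T i).height_iterate] using congrArg (T i).height (h i x)
  have hpar : ∀ i x, (n i ((T i).parent x) : ℤ) - m i ((T i).parent x) = n i x - m i x + 1 := by
    intro i x
    have h1 := hheight i x
    have h2 := hheight i ((T i).parent x)
    rw [(T i).height_parent] at h2
    linarith
  have hoff : ∀ i, ξ.offset i + extend m ξ i + (n i (ξ.vertex i) : ℝ) - m i (ξ.vertex i)
      = extend n ξ i := by
    intro i
    have h1 : (n i ((T i).parent (ξ.vertex i)) : ℝ) - m i ((T i).parent (ξ.vertex i)) =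
      n i (ξ.vertex i) - m i (ξ.vertex i) + 1 := by exact_mod_cast hpar i (ξ.vertex i)
    unfold extend
    linear_combination (-ξ.offset i) * h1
  -- The travelled distance is a convex combination of two meeting times, one through the vertex and
  -- one through its parent, so it is at least the smaller of them.
  have hmin : ∀ i, ∃ k l : ℕ, (T i).parent^[k] (ξ.vertex i) = (T i).parent^[l] (b i) ∧
      (k : ℝ) ≤ ξ.offset i + extend m ξ i ∧
      (l : ℝ) - k = n i (ξ.vertex i) - m i (ξ.vertex i) := by
    intro i
    have h0 := ξ.offset_nonneg i
    have h1 := ξ.offset_lt_one i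
    rcases le_total (m i (ξ.vertex i)) (m i ((T i).parent (ξ.vertex i)) + 1) with hle | hle
    · refine ⟨m i (ξ.vertex i), n i (ξ.vertex i), h i _, ?_, rfl⟩
      have hle' : (m i (ξ.vertex i) : ℝ) ≤ m i ((T i).parent (ξ.vertex i)) + 1 := by
        exact_mod_cast hle
      unfold extend
      nlinarith [mul_le_mul_of_nonneg_left hle' h0]
    · refine ⟨m i ((T i).parent (ξ.vertex i)) + 1, n i ((T i).parent (ξ.vertex i)), ?_, ?_, ?_⟩
      · rw [Function.iterate_succ_apply]
        exact h i _
      · have hle' : (m i ((T i).parent (ξ.vertex i)) : ℝ) + 1 ≤ m i (ξ.vertex i) := by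
          exact_mod_cast hle
        unfold extend
        push_cast
        nlinarith [mul_le_mul_of_nonneg_left hle' (sub_nonneg.2 h1.le)]
      · have h1 : (n i ((T i).parent (ξ.vertex i)) : ℝ) - m i ((T i).parent (ξ.vertex i)) =
          n i (ξ.vertex i) - m i (ξ.vertex i) + 1 := by exact_mod_cast hpar i (ξ.vertex i)
        push_cast
        linarith
  choose k l hkl hk hl using hmin
  have e1 := flow_iterate ξ.vertex k (r := fun i => ξ.offset i + extend m ξ i - k i)
    fun i => sub_nonneg.2 (hk i)
  have e2 := flow_iterate b l (r := fun i => ξ.offset i + extend m ξ i - k i)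
    fun i => sub_nonneg.2 (hk i)
  simp only [← hkl, e1] at e2
  simp only [flowUp, one_mul]
  convert! e2 using 2
  · funext i; ring
  · funext i; linarith [hoff i, hl i]

instance [Finite ι] : ContractibleSpace (Realization T) := by
  have b : ∀ i, (T i).Vertex := fun i => (T i).nonempty.some
  choose m n h using fun i x => (T i).exists_iterate_eq x (b i)
  rw [contractible_iff_id_nullhomotopic]
  refine ⟨flow b 0, ?_⟩
  let f : C(Realization T, Realization T) := ⟨fun ξ => flow b (extend n ξ), by
    have := (continuous_flow_extend n b).comp (Continuous.prodMk_left (0 : unitInterval))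
    simpa [Function.comp_def] using this⟩
  -- First push every point up onto the rays from `b`, then retract along these rays to `b`.
  refine ContinuousMap.Homotopic.trans (g := f) ⟨?_⟩ ⟨?_⟩
  · exact {
      toFun p := flowUp m p.1 p.2
      continuous_toFun := (continuous_flowUp m).comp continuous_swap
      map_zero_left ξ := by simp [flowUp]
      map_one_left ξ := by simpa [f] using flowUp_one_eq h ξ }
  · exact {
      toFun p := flow b fun i => (1 - p.1 : ℝ) * extend n p.2 i
      continuous_toFun := (continuous_flow_extend n b).comp continuous_swap
      map_zero_left ξ := by simp [f]
      map_one_left ξ := by simp; rfl }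

end Realization

/-! ### The CW structure by cubes -/

namespace Realization

variable {ι : Type u} {T : ι → EndedTree.{u}}

/-- The open cell at `x` in the directions `S`. -/
def stratum (x : ∀ i, (T i).Vertex) (S : Finset ι) : Set (Realization T) :=
  {ξ | ξ.vertex = x ∧ ∀ i, ξ.offset i ≠ 0 ↔ i ∈ S}

open Classical in
/-- The coordinates, in the cube at `x`, of the characteristic map of a cell. -/
noncomputable def cellCoord {n : ℕ} {S : Finset ι} (e : S ≃ Fin n) (y : Fin n → ℝ) (i : ι) : ℝ :=
  -- The unit ball of `Fin n → ℝ` is a cube in the sup norm, on which this is (1 + y)/2; the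
  -- clamping keeps the values in [0, 1] everywhere else.
  if h : i ∈ S then max 0 (min 1 ((1 + y (e ⟨i, h⟩)) / 2)) else 0

section cellCoord

variable {n : ℕ} {S : Finset ι} (e : S ≃ Fin n)

theorem cellCoord_nonneg (y : Fin n → ℝ) (i : ι) : 0 ≤ cellCoord e y i := by
  unfold cellCoord
  split_ifs
  · exact le_max_left _ _
  · exact le_rfl

theorem cellCoord_le_one (y : Fin n → ℝ) (i : ι) : cellCoord e y i ≤ 1 := by
  unfold cellCoord
  split_ifs
  · exact max_le zero_le_one (min_le_left _ _)
  · exact zero_le_one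

theorem continuous_cellCoord : Continuous (cellCoord e) := by
  refine continuous_pi fun i => ?_
  unfold cellCoord
  split_ifs
  · fun_prop
  · exact continuous_const

theorem cellCoord_of_notMem (y : Fin n → ℝ) {i : ι} (h : i ∉ S) : cellCoord e y i = 0 := by
  rw [cellCoord, dif_neg h]

theorem cellCoord_of_mem {y : Fin n → ℝ} (hy : ∀ j, |y j| ≤ 1) {i : ι} (h : i ∈ S) :
    cellCoord e y i = (1 + y (e ⟨i, h⟩)) / 2 := by
  have := abs_le.1 (hy (e ⟨i, h⟩))
  rw [cellCoord, dif_pos h, min_eq_right (by linarith), max_eq_right (by linarith)]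

theorem cellCoord_lt_one {y : Fin n → ℝ} (hy : ∀ j, |y j| < 1) (i : ι) : cellCoord e y i < 1 := by
  by_cases h : i ∈ S
  · rw [cellCoord_of_mem e (fun j => (hy j).le) h]
    linarith [(abs_lt.1 (hy (e ⟨i, h⟩))).2]
  · rw [cellCoord_of_notMem e y h]
    exact zero_lt_one

/-- The characteristic map of a cell. -/
noncomputable def cellMap (x : ∀ i, (T i).Vertex) (y : Fin n → ℝ) : Realization T :=
  flow x (cellCoord e y)

theorem continuous_cellMap [Finite ι] (x : ∀ i, (T i).Vertex) : Continuous (cellMap e x) :=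
  continuous_flow x (N := 1) (continuous_cellCoord e) (cellCoord_nonneg e)
    fun y i => by exact_mod_cast cellCoord_le_one e y i

theorem cellMap_of_lt_one (x : ∀ i, (T i).Vertex) {y : Fin n → ℝ} (hy : ∀ j, |y j| < 1) :
    cellMap e x y = ⟨x, cellCoord e y, cellCoord_nonneg e y, cellCoord_lt_one e hy⟩ :=
  flow_of_lt_one _ _

theorem mem_ball_iff_abs {y : Fin n → ℝ} : y ∈ Metric.ball (0 : Fin n → ℝ) 1 ↔ ∀ j, |y j| < 1 := by
  simp [pi_norm_lt_iff zero_lt_one]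

/-- The characteristic map of a cell, as a bijection of the open ball onto the open cell. -/
noncomputable def cellEquiv (x : ∀ i, (T i).Vertex) : PartialEquiv (Fin n → ℝ) (Realization T) where
  toFun := cellMap e x
  invFun ξ j := 2 * ξ.offset (e.symm j) - 1
  source := Metric.ball 0 1
  target := stratum x S
  map_source' y hy := by
    rw [mem_ball_iff_abs] at hy
    rw [cellMap_of_lt_one e x hy]
    refine ⟨rfl, fun i => ⟨fun h => ?_, fun h => ?_⟩⟩
    · by_contra hi
      exact h (cellCoord_of_notMem e y hi)
    · change cellCoord e y i ≠ 0
      rw [cellCoord_of_mem e (fun j => (hy j).le) h]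
      linarith [(abs_lt.1 (hy (e ⟨i, h⟩))).1]
  map_target' ξ hξ := by
    rw [mem_ball_iff_abs]
    intro j
    have h0 := lt_of_le_of_ne (ξ.offset_nonneg (e.symm j)) ((hξ.2 _).2 (e.symm j).2).symm
    have h1 := ξ.offset_lt_one (e.symm j)
    exact abs_lt.2 ⟨by linarith, by linarith⟩
  left_inv' y hy := by
    rw [mem_ball_iff_abs] at hy
    funext j
    rw [cellMap_of_lt_one e x hy]
    change 2 * cellCoord e y (e.symm j) - 1 = y j
    rw [cellCoord_of_mem e (fun j => (hy j).le) (e.symm j).2]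
    simp
    ring
  right_inv' ξ hξ := by
    have hy : ∀ j, |2 * ξ.offset (e.symm j) - 1| < 1 := fun j => by
      have h0 := lt_of_le_of_ne (ξ.offset_nonneg (e.symm j)) ((hξ.2 _).2 (e.symm j).2).symm
      have h1 := ξ.offset_lt_one (e.symm j)
      exact abs_lt.2 ⟨by linarith, by linarith⟩
    rw [cellMap_of_lt_one e x hy]
    ext i
    · exact (congrFun hξ.1 i).symm
    · change cellCoord e (fun j => 2 * ξ.offset (e.symm j) - 1) i = ξ.offset i
      by_cases h : i ∈ S
      · rw [cellCoord_of_mem e (fun j => (hy j).le) h]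
        simp
      · rw [cellCoord_of_notMem e _ h]
        by_contra hne
        exact h ((hξ.2 i).1 (Ne.symm hne))

theorem image_cellMap_ball (x : ∀ i, (T i).Vertex) :
    cellMap e x '' Metric.ball 0 1 = stratum x S :=
  (cellEquiv e x).image_source_eq_target

end cellCoord

open Classical in
/-- The directions of the open cell containing `ξ`. -/
noncomputable def support [Fintype ι] (ξ : Realization T) : Finset ι :=
  Finset.univ.filter fun i => ξ.offset i ≠ 0

theorem mem_stratum_support [Fintype ι] (ξ : Realization T) : ξ ∈ stratum ξ.vertex ξ.support :=
  ⟨rfl, fun i => by simp [support]⟩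

theorem disjoint_stratum {x x' : ∀ i, (T i).Vertex} {S S' : Finset ι} (h : (x, S) ≠ (x', S')) :
    Disjoint (stratum x S) (stratum x' S') := by
  rw [Set.disjoint_left]
  rintro ξ ⟨h1, h2⟩ ⟨h1', h2'⟩
  exact h (Prod.ext (h1.symm.trans h1') (Finset.ext fun i => (h2 i).symm.trans (h2' i)))

theorem cube_mem_image_cellMap [Fintype ι] {n : ℕ} (e : (Finset.univ : Finset ι) ≃ Fin n)
    (x : ∀ i, (T i).Vertex) (q : ι → unitInterval) :
    cube x q ∈ cellMap e x '' Metric.closedBall 0 1 := by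
  have hy : ∀ j, |2 * (q (e.symm j) : ℝ) - 1| ≤ 1 := fun j =>
    abs_le.2 ⟨by linarith [(q (e.symm j)).2.1], by linarith [(q (e.symm j)).2.2]⟩
  refine ⟨fun j => 2 * q (e.symm j) - 1, ?_, ?_⟩
  · rw [mem_closedBall_zero_iff, pi_norm_le_iff_of_nonneg zero_le_one]
    exact hy
  · refine congrArg (flow x) (funext fun i => ?_)
    rw [cellCoord_of_mem e hy (Finset.mem_univ i)]
    simp

/-- Cells are indexed by a vertex and a set of directions. -/
abbrev Cell (T : ι → EndedTree.{u}) (n : ℕ) : Type u :=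
  {c : (∀ i, (T i).Vertex) × Finset ι // c.2.card = n}

/-- The characteristic map of a cell. -/
noncomputable abbrev Cell.map {n : ℕ} (c : Cell T n) : PartialEquiv (Fin n → ℝ) (Realization T) :=
  cellEquiv (Finset.equivFinOfCardEq c.2) c.1.1

theorem Cell.image_ball {n : ℕ} (c : Cell T n) :
    c.map '' Metric.ball 0 1 = stratum c.1.1 c.1.2 :=
  image_cellMap_ball _ _

theorem Cell.continuousOn_symm {n : ℕ} (c : Cell T n) :
    ContinuousOn c.map.symm c.map.target := by
  refine continuousOn_pi.2 fun j => ?_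
  let i : ι := ((Finset.equivFinOfCardEq c.2).symm j).1
  have h : Continuous fun ξ : Realization T => 2 * coord i ((T i).parent (c.1.1 i)) ξ - 1 :=
    (continuous_const.mul (continuous_coord _ _)).sub continuous_const
  refine h.continuousOn.congr fun ξ hξ => ?_
  change 2 * ξ.offset i - 1 = 2 * coord i ((T i).parent (c.1.1 i)) ξ - 1
  rw [← congrFun hξ.1 i, coord_parent]

/-- On the sphere some coordinate is ±1, so its offset becomes 0 and the support shrinks strictly.
The vertex moves at most to the parent in each factor, which leaves finitely many cells. -/
theorem Cell.exists_mapsTo_sphere [Fintype ι] {n : ℕ} (c : Cell T n) :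
    ∃ I : ∀ m, Finset (Cell T m), MapsTo c.map (Metric.sphere 0 1)
      (⋃ (m < n) (d ∈ I m), d.map '' Metric.closedBall 0 1) := by
  obtain ⟨⟨x, S⟩, hS⟩ := c
  have hfin : ∀ m, {d : Cell T m | d.1 ∈
      (Set.pi univ fun i => ({x i, (T i).parent (x i)} : Set _)) ×ˢ univ}.Finite := fun m =>
    ((Set.Finite.pi fun i => Set.toFinite _).prod Set.finite_univ).preimage
      Subtype.val_injective.injOn
  refine ⟨fun m => (hfin m).toFinset, fun y hy => ?_⟩
  rw [mem_sphere_zero_iff_norm] at hy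
  set e := Finset.equivFinOfCardEq hS with he
  have hy1 : ∀ j, |y j| ≤ 1 := fun j => hy ▸ norm_le_pi_norm y j
  have hoff : ∀ i, i ∉ S → (cellMap e x y).offset i = 0 := fun i hi => by
    simp [cellMap, flow, cellCoord_of_notMem e y hi]
  have hsub : (cellMap e x y).support ⊂ S := by
    refine Finset.ssubset_iff_subset_ne.2 ⟨fun i hi => ?_, fun heq => ?_⟩
    · by_contra h
      exact ((mem_stratum_support _).2 i).2 hi (hoff i h)
    · have : ‖y‖ < 1 := by
        refine (pi_norm_lt_iff zero_lt_one).2 fun j => lt_of_le_of_ne (hy1 j) fun hj => ?_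
        have hmem := (e.symm j).2
        have hne := ((mem_stratum_support (cellMap e x y)).2 (e.symm j)).2 (by rw [heq]; exact hmem)
        refine hne ?_
        change Int.fract (cellCoord e y (e.symm j)) = 0
        rw [cellCoord_of_mem e hy1 hmem, Subtype.coe_eta, e.apply_symm_apply]
        rcases eq_or_eq_neg_of_abs_eq hj with h | h <;> simp [h]
      exact this.ne hy
  have hcard : (cellMap e x y).support.card < n := (Finset.card_lt_card hsub).trans_eq hS
  refine mem_iUnion₂.2 ⟨_, hcard, mem_iUnion₂.2
    ⟨⟨((cellMap e x y).vertex, (cellMap e x y).support), rfl⟩, ?_, ?_⟩⟩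
  · rw [Set.Finite.mem_toFinset]
    refine ⟨fun i _ => ?_, mem_univ _⟩
    change (T i).parent^[⌊cellCoord e y i⌋₊] (x i) ∈ _
    have : ⌊cellCoord e y i⌋₊ ≤ 1 := Nat.floor_le_of_le (by exact_mod_cast cellCoord_le_one e y i)
    interval_cases ⌊cellCoord e y i⌋₊ <;> simp
  · refine image_mono Metric.ball_subset_closedBall ?_
    rw [Cell.image_ball]
    exact mem_stratum_support _

noncomputable instance [Fintype ι] : CWComplex (univ : Set (Realization T)) where
  cell := Cell T
  map n c := c.map
  source_eq n c := rfl
  continuousOn n c := (continuous_cellMap _ _).continuousOn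
  continuousOn_symm n c := c.continuousOn_symm
  pairwiseDisjoint' := by
    rintro ⟨n, c⟩ - ⟨n', c'⟩ - h
    simp only [Function.onFun, Cell.image_ball]
    refine disjoint_stratum fun heq => h ?_
    obtain ⟨c, rfl⟩ := c
    obtain ⟨c', rfl⟩ := c'
    obtain rfl : c = c' := heq
    rfl
  mapsTo' n c := c.exists_mapsTo_sphere
  closed' A _ hA := by
    -- The cells in all directions suffice, since their closures contain the closed cubes that
    -- define the topology.
    refine isClosed_iff_cube.2 fun x => ?_
    convert! (hA _ ⟨(x, Finset.univ), rfl⟩).preimage (continuous_cube x) using 1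
    ext q
    exact ⟨fun h => ⟨h, cube_mem_image_cellMap _ x q⟩, fun h => h.1⟩
  union' := by
    refine eq_univ_of_forall fun ξ => mem_iUnion₂.2 ⟨_, ⟨(ξ.vertex, ξ.support), rfl⟩, ?_⟩
    refine image_mono Metric.ball_subset_closedBall ?_
    rw [Cell.image_ball]
    exact mem_stratum_support _

theorem openCell_eq [Fintype ι] {n : ℕ} (c : Cell T n) :
    RelCWComplex.openCell (C := (univ : Set (Realization T))) n c = stratum c.1.1 c.1.2 :=
  c.image_ball

instance [Fintype ι] : RelCWComplex.FiniteDimensional (univ : Set (Realization T)) where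
  eventually_isEmpty_cell := by
    filter_upwards [Filter.eventually_gt_atTop (Fintype.card ι)] with n hn
    exact ⟨fun c : Cell T n => (c.2 ▸ Finset.card_le_univ c.1.2).not_gt hn⟩

/-! ### The group action on the product -/

section Action

variable {G : Type u} [Group G] [∀ i, MulAction G (T i).Vertex]

instance : MulAction G (Realization T) where
  smul g ξ := ⟨fun i => g • ξ.vertex i, ξ.offset, ξ.offset_nonneg, ξ.offset_lt_one⟩
  one_smul ξ := Realization.ext (funext fun i => one_smul G (ξ.vertex i)) rfl
  mul_smul g h ξ := Realization.ext (funext fun i => mul_smul g h (ξ.vertex i)) rfl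

theorem smul_vertex (g : G) (ξ : Realization T) : (g • ξ).vertex = g • ξ.vertex := rfl

theorem smul_cube (hT : ∀ i (g : G) (x : (T i).Vertex), (T i).parent (g • x) = g • (T i).parent x)
    (g : G) (x : ∀ i, (T i).Vertex) (q : ι → unitInterval) : g • cube x q = cube (g • x) q := by
  refine Realization.ext (funext fun i => ?_) rfl
  exact ((Function.Commute.iterate_left (hT i g) _) (x i)).symm

theorem image_smul_stratum (g : G) (x : ∀ i, (T i).Vertex) (S : Finset ι) :
    (fun ξ : Realization T => g • ξ) '' stratum x S = stratum (g • x) S := by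
  ext ξ
  constructor
  · rintro ⟨ξ, ⟨rfl, h⟩, rfl⟩
    exact ⟨rfl, h⟩
  · rintro ⟨h, h'⟩
    refine ⟨g⁻¹ • ξ, ⟨?_, h'⟩, smul_inv_smul g ξ⟩
    rw [smul_vertex, h, inv_smul_smul]

/-- The action preserves offsets and directions, so an element preserving a cell fixes its base
vertex and therefore each of its points; no subdivision is needed. -/
theorem isGComplex [Fintype ι]
    (hT : ∀ i (g : G) (x : (T i).Vertex), (T i).parent (g • x) = g • (T i).parent x) :
    IsGComplex G (Realization T) where
  continuous_smul g := continuous_iff_cube.2 fun x => by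
    simp only [smul_cube hT]
    exact continuous_cube _
  exists_image_openCell g n c := by
    change Cell T n at c
    refine ⟨(⟨(g • c.1.1, c.1.2), c.2⟩ : Cell T n), ?_⟩
    rw [openCell_eq, openCell_eq, image_smul_stratum]
  smul_eq_of_image_openCell g n c h ξ hξ := by
    change Cell T n at c
    rw [openCell_eq] at hξ h
    rw [image_smul_stratum] at h
    have hmem : g • ξ ∈ stratum c.1.1 c.1.2 := by
      rw [← h, ← image_smul_stratum]
      exact mem_image_of_mem _ hξ
    exact Realization.ext (hmem.1.trans hξ.1.symm) rfl

theorem stabilizer_eq (ξ : Realization T) :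
    MulAction.stabilizer G ξ = MulAction.stabilizer G ξ.vertex := by
  ext g
  simp only [MulAction.mem_stabilizer_iff]
  exact ⟨fun h => congrArg vertex h, fun h => Realization.ext h rfl⟩

end Action

end Realization

/-- A group acting on finitely many trees, fixing an end of each, acts on a finite dimensional
contractible complex whose stabilizers are the simultaneous vertex stabilizers. -/
theorem actsWithStabilizersIn_of_trees {𝔛 : (G : Type u) → [Group G] → Prop} {G : Type u} [Group G]
    {ι : Type u} [Finite ι] (T : ι → EndedTree.{u}) [∀ i, MulAction G (T i).Vertex]
    (hT : ∀ i (g : G) (x : (T i).Vertex), (T i).parent (g • x) = g • (T i).parent x)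
    (h𝔛 : ∀ x : ∀ i, (T i).Vertex, 𝔛 (MulAction.stabilizer G x)) : ActsWithStabilizersIn 𝔛 G := by
  cases nonempty_fintype ι
  refine ⟨Realization T, inferInstance, inferInstance, inferInstance, inferInstance,
    Realization.isGComplex hT, inferInstance, inferInstance, fun ξ => ?_⟩
  rw [Realization.stabilizer_eq]
  exact h𝔛 _

/-! ### Closure under embeddings, and free abelian groups -/

/-- A class of groups is closed under subgroups and isomorphisms. -/
def ClosedUnderEmbeddings (𝔛 : (G : Type u) → [Group G] → Prop) : Prop :=
  ∀ (G H : Type u) [Group G] [Group H] (f : H →* G), Function.Injective f → 𝔛 G → 𝔛 H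

theorem finiteGroups_closedUnderEmbeddings : ClosedUnderEmbeddings FiniteGroups.{u} := by
  intro G H _ _ f hf hG
  have : Finite G := hG
  exact Finite.of_injective f hf

/-- Pull the action back along the embedding; the new stabilizers embed in the old ones. -/
theorem ClosedUnderEmbeddings.actsWithStabilizersIn {𝔛 : (G : Type u) → [Group G] → Prop}
    (h𝔛 : ClosedUnderEmbeddings 𝔛) : ClosedUnderEmbeddings (ActsWithStabilizersIn 𝔛) := by
  rintro G H _ _ f hf ⟨X, _, _, _, _, hX, hc, hd, hs⟩
  let _ : MulAction H X := MulAction.compHom X f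
  have hsmul : ∀ (h : H) (x : X), h • x = f h • x := fun _ _ => rfl
  refine ⟨X, inferInstance, inferInstance, inferInstance, inferInstance, ⟨fun h => ?_, ?_, ?_⟩,
    hc, hd, fun x => ?_⟩
  · exact hX.continuous_smul (f h)
  · exact fun h => hX.exists_image_openCell (f h)
  · exact fun h => hX.smul_eq_of_image_openCell (f h)
  · let φ : MulAction.stabilizer H x →* MulAction.stabilizer G x :=
      (f.comp (MulAction.stabilizer H x).subtype).codRestrict (MulAction.stabilizer G x)
        fun h => h.2
    refine h𝔛 _ _ φ (fun a b hab => ?_) (hs x)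
    exact Subtype.ext (hf (congrArg Subtype.val hab))

theorem HClass_natCast_closedUnderEmbeddings (n : ℕ) :
    ClosedUnderEmbeddings (HClass FiniteGroups.{u} n) := by
  induction n with
  | zero =>
    intro G H _ _ f hf hG
    rw [Nat.cast_zero, HClass_zero] at hG ⊢
    exact finiteGroups_closedUnderEmbeddings G H f hf hG
  | succ n ih =>
    intro G H _ _ f hf hG
    rw [Nat.cast_succ, HClass_add_one] at hG ⊢
    exact ih.actsWithStabilizersIn G H f hf hG

/-- The line, as a tree with a distinguished end. -/
def lineTree : EndedTree.{0} where
  Vertex := ℤ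
  parent x := x + 1
  height x := x
  height_parent _ := rfl
  exists_iterate_eq x y := by
    have h : ∀ (n : ℕ) (x : ℤ), (fun x : ℤ => x + 1)^[n] x = x + n := fun n x => by simp
    refine ⟨(y - x).toNat, (x - y).toNat, ?_⟩
    rw [h, h]
    omega
  nonempty := ⟨(0 : ℤ)⟩

/-- Free abelian groups of finite rank act freely on Euclidean space. -/
theorem HClass_one_freeAbelian (n : ℕ) :
    HClass FiniteGroups 1 (Multiplicative (Fin n → ℤ)) := by
  have h1 : (1 : Ordinal.{0}) = 0 + 1 := (zero_add 1).symm
  rw [h1, HClass_add_one]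
  let A : Fin n → MulAction (Multiplicative (Fin n → ℤ)) ℤ := fun i =>
    { smul := fun g x => g.toAdd i + x
      one_smul := fun x => zero_add x
      mul_smul := fun g h x => add_assoc (g.toAdd i) (h.toAdd i) x }
  refine @actsWithStabilizersIn_of_trees _ _ _ _ _ (fun _ => lineTree) A
    (fun i g x => add_assoc (g.toAdd i) x 1) fun x => ?_
  rw [HClass_zero]
  refine @Finite.of_subsingleton _ ?_
  refine ⟨fun g h => Subtype.ext (Multiplicative.toAdd.injective (funext fun i => ?_))⟩
  let y : ℤ := x i
  have hg : g.1.toAdd i + y = y := congrFun g.2 i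
  have hh : h.1.toAdd i + y = y := congrFun h.2 i
  exact add_right_cancel (hg.trans hh.symm)

/-! ### Increasing unions of subgroups -/

section DirectedUnion

variable {G : Type u} [Group G] (K : ℕ → Subgroup G)

/-- The tree of cosets of an increasing chain of subgroups exhausting a group. -/
def cosetTree (hK : Monotone K) (hG : ∀ g, ∃ n, g ∈ K n) : EndedTree.{u} where
  Vertex := Σ n, G ⧸ K n
  parent p := ⟨p.1 + 1, Subgroup.quotientMapOfLE (hK p.1.le_succ) p.2⟩
  height p := p.1
  height_parent p := by push_cast; rfl
  exists_iterate_eq := by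
    have key : ∀ (k n : ℕ) (g : G),
        (fun p : Σ n, G ⧸ K n => (⟨p.1 + 1, Subgroup.quotientMapOfLE (hK p.1.le_succ) p.2⟩ :
          Σ n, G ⧸ K n))^[k] ⟨n, (g : G ⧸ K n)⟩ = ⟨n + k, (g : G ⧸ K (n + k))⟩ := by
      intro k n g
      induction k with
      | zero => rfl
      | succ k ih => rw [Function.iterate_succ_apply', ih]; rfl
    rintro ⟨m, x⟩ ⟨n, y⟩
    obtain ⟨g, rfl⟩ := QuotientGroup.mk_surjective x
    obtain ⟨h, rfl⟩ := QuotientGroup.mk_surjective y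
    obtain ⟨k, hk⟩ := hG (g⁻¹ * h)
    -- Both cosets are raised to level m + n + k, which is at least `k`, so the subgroup there
    -- contains g⁻¹h.
    refine ⟨n + k, m + k, ?_⟩
    rw [key, key]
    have e : m + (n + k) = n + (m + k) := by omega
    rw [← e]
    congr 1
    exact QuotientGroup.eq.2 (hK (by omega) hk)
  nonempty := ⟨⟨0, ((1 : G) : G ⧸ K 0)⟩⟩

instance (hK : Monotone K) (hG : ∀ g, ∃ n, g ∈ K n) : MulAction G (cosetTree K hK hG).Vertex :=
  inferInstanceAs (MulAction G (Σ n, G ⧸ K n))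

/-- A countable increasing union of groups acts on a tree with stabilizers in these groups. -/
theorem actsWithStabilizersIn_of_directedUnion (hK : Monotone K) (hG : ∀ g, ∃ n, g ∈ K n)
    {𝔛 : (G : Type u) → [Group G] → Prop}
    (h𝔛 : ClosedUnderEmbeddings 𝔛) (hK𝔛 : ∀ n, 𝔛 (K n)) : ActsWithStabilizersIn 𝔛 G := by
  refine actsWithStabilizersIn_of_trees (fun _ : PUnit.{u + 1} => cosetTree K hK hG) ?_ fun x => ?_
  · rintro - g ⟨n, x⟩
    obtain ⟨h, rfl⟩ := QuotientGroup.mk_surjective x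
    rfl
  · obtain ⟨n, y, hy⟩ : ∃ n, ∃ y : G, x ⟨⟩ = (⟨n, (y : G ⧸ K n)⟩ : Σ n, G ⧸ K n) := by
      obtain ⟨y, hy⟩ := QuotientGroup.mk_surjective (x ⟨⟩).2
      exact ⟨_, y, by rw [hy]; rfl⟩
    have hmem : ∀ g ∈ MulAction.stabilizer G x, y⁻¹ * g * y ∈ K n := by
      intro g hg
      have h1 : g • (⟨n, (y : G ⧸ K n)⟩ : Σ n, G ⧸ K n) = ⟨n, (y : G ⧸ K n)⟩ := by
        rw [← hy]; exact congrFun hg ⟨⟩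
      have h2 : ((g * y : G) : G ⧸ K n) = y := eq_of_heq (Sigma.mk.inj h1).2
      have h3 := (K n).inv_mem (QuotientGroup.eq.1 h2)
      simpa [mul_assoc] using h3
    let φ : MulAction.stabilizer G x →* K n :=
      ((MulAut.conj y⁻¹).toMonoidHom.comp (MulAction.stabilizer G x).subtype).codRestrict (K n)
        fun g => by simpa [MulAut.conj_apply] using hmem g g.2
    refine h𝔛 _ _ φ (fun a b hab => ?_) (hK𝔛 n)
    exact Subtype.ext ((MulAut.conj y⁻¹).injective (congrArg Subtype.val hab))

end DirectedUnion

/-! ### Trees of balls and affine actions -/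

open WithZero in
/-- Radii and centres describing the same ball of a field with a discrete valuation. -/
def ballSetoid {K : Type u} [Field K] (v : Valuation K (WithZero (Multiplicative ℤ))) :
    Setoid (ℤ × K) where
  -- The radius exponent is part of the data, so the height is well defined even when `v` is not
  -- surjective.
  r p q := p.1 = q.1 ∧ v (p.2 - q.2) ≤ exp p.1
  iseqv := by
    refine ⟨fun p => ⟨rfl, by simp⟩, fun h => ⟨h.1.symm, ?_⟩, fun h h' => ⟨h.1.trans h'.1, ?_⟩⟩
    · rw [Valuation.map_sub_swap, ← h.1]
      exact h.2
    · rw [← sub_add_sub_cancel]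
      exact (v.map_add _ _).trans (max_le h.2 (h.1 ▸ h'.2))

section BallTree

open WithZero

variable {K : Type u} [Field K] (v : Valuation K (WithZero (Multiplicative ℤ)))

/-- The tree of balls of a field with a discrete valuation; the parent of a ball is the next larger
ball with the same centre. -/
def ballTree : EndedTree.{u} where
  Vertex := Quotient (ballSetoid v)
  parent := Quotient.map (fun p => (p.1 + 1, p.2)) fun p q h =>
    ⟨congrArg (· + 1) h.1, h.2.trans (exp_le_exp.2 (by simp))⟩
  height := Quotient.lift Prod.fst fun p q h => h.1
  height_parent := by
    rintro ⟨p⟩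
    rfl
  exists_iterate_eq := by
    have key : ∀ (k : ℕ) (p : ℤ × K), (Quotient.map (fun p => (p.1 + 1, p.2)) fun p q h =>
        ⟨congrArg (· + 1) h.1, h.2.trans (exp_le_exp.2 (by simp))⟩ :
          Quotient (ballSetoid v) → Quotient (ballSetoid v))^[k] ⟦p⟧ = ⟦(p.1 + k, p.2)⟧ := by
      intro k p
      induction k with
      | zero => simp
      | succ k ih =>
        rw [Function.iterate_succ_apply', ih]
        refine congrArg (Quotient.mk (ballSetoid v)) (Prod.ext ?_ rfl)
        push_cast
        ring
    rintro ⟨m, x⟩ ⟨n, y⟩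
    obtain ⟨N, hN⟩ : ∃ N : ℤ, v (x - y) ≤ exp N := by
      rcases eq_or_ne (v (x - y)) 0 with h | h
      · exact ⟨0, h ▸ zero_le⟩
      · exact ⟨log (v (x - y)), (exp_log h).ge⟩
    let M := max N (max m n)
    refine ⟨(M - m).toNat, (M - n).toNat, ?_⟩
    refine (key _ _).trans (Eq.trans ?_ (key _ _).symm)
    have h1 : m + ((M - m).toNat : ℤ) = M := by omega
    have h2 : n + ((M - n).toNat : ℤ) = M := by omega
    refine Quotient.sound ⟨h1.trans h2.symm, hN.trans (exp_le_exp.2 ?_)⟩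
    change N ≤ m + ((M - m).toNat : ℤ)
    omega
  nonempty := ⟨⟦(0, 0)⟧⟩

end BallTree

/-- An action of a group on a field by affine maps `x ↦ linear g * x + translation g`. -/
structure AffineAction (G K : Type u) [Group G] [Field K] where
  linear : G →* Kˣ
  translation : G → K
  translation_mul : ∀ g h, translation (g * h) = translation g + linear g * translation h

namespace AffineAction

open WithZero

variable {G K : Type u} [Group G] [Field K] (ρ : AffineAction G K)

theorem translation_one : ρ.translation 1 = 0 := by
  have := ρ.translation_mul 1 1
  simpa using this

theorem translation_inv (g : G) :
    ρ.translation g⁻¹ = -(((ρ.linear g)⁻¹ : Kˣ) * ρ.translation g) := by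
  have := ρ.translation_mul g⁻¹ g
  rw [inv_mul_cancel, translation_one, map_inv] at this
  linear_combination -this

/-- Restriction to a subgroup. -/
def restrict (H : Subgroup G) : AffineAction H K where
  linear := ρ.linear.comp H.subtype
  translation h := ρ.translation h
  translation_mul g h := ρ.translation_mul g h

variable (v : Valuation K (WithZero (Multiplicative ℤ)))

/-- The subgroup of the elements that are integral with respect to a valuation. -/
def integral : Subgroup G where
  carrier := {g | v (ρ.linear g) = 1 ∧ v (ρ.translation g) ≤ 1}
  one_mem' := by simp [translation_one]
  mul_mem' := by
    rintro g h ⟨h1, h2⟩ ⟨h3, h4⟩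
    refine ⟨by simp [h1, h3], ?_⟩
    rw [ρ.translation_mul]
    refine (v.map_add _ _).trans (max_le h2 ?_)
    rwa [map_mul, h1, one_mul]
  inv_mem' := by
    rintro g ⟨h1, h2⟩
    refine ⟨by simp [h1], ?_⟩
    rw [ρ.translation_inv, Valuation.map_neg, map_mul, Units.val_inv_eq_inv_val, map_inv₀, h1]
    simpa using h2

/-- The action on the tree of balls. -/
abbrev ballTreeMulAction : MulAction G (ballTree v).Vertex where
  smul g := Quotient.map
    (fun p => (log (v (ρ.linear g)) + p.1, ρ.linear g * p.2 + ρ.translation g)) fun p q h => by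
      refine ⟨congrArg (log (v (ρ.linear g)) + ·) h.1, ?_⟩
      change v ((ρ.linear g * p.2 + ρ.translation g) - (ρ.linear g * q.2 + ρ.translation g)) ≤
        exp (log (v (ρ.linear g)) + p.1)
      rw [add_sub_add_right_eq_sub, ← mul_sub, map_mul, exp_add, exp_log (by simp)]
      exact mul_le_mul_right h.2 _
  one_smul := by
    rintro ⟨p⟩
    refine congrArg (Quotient.mk (ballSetoid v)) (Prod.ext ?_ ?_) <;> simp [translation_one]
  mul_smul := by
    rintro g h ⟨p⟩
    refine congrArg (Quotient.mk (ballSetoid v)) (Prod.ext ?_ ?_)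
    · change log (v (ρ.linear (g * h))) + p.1 = _ + (_ + p.1)
      rw [map_mul, Units.val_mul, map_mul, log_mul (by simp) (by simp), add_assoc]
    · change ρ.linear (g * h) * p.2 + ρ.translation (g * h) =
        ρ.linear g * (ρ.linear h * p.2 + ρ.translation h) + ρ.translation g
      rw [ρ.translation_mul, map_mul, Units.val_mul]
      ring

/-- An affine map scales radii by the valuation of its linear part. Fixing a ball thus forces that
valuation to be 1 and keeps the image of the centre inside the ball. -/
theorem actsWithStabilizersIn {𝔛 : (G : Type u) → [Group G] → Prop} {ι : Type u} [Finite ι]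
    (v : ι → Valuation K (WithZero (Multiplicative ℤ)))
    (h𝔛 : ∀ (n : ι → ℤ) (c : ι → K) (H : Subgroup G),
      (∀ g ∈ H, ∀ i, v i (ρ.linear g) = 1 ∧
        v i (ρ.linear g * c i + ρ.translation g - c i) ≤ exp (n i)) → 𝔛 H) :
    ActsWithStabilizersIn 𝔛 G := by
  let _ : ∀ i, MulAction G (ballTree (v i)).Vertex := fun i => ρ.ballTreeMulAction (v i)
  refine actsWithStabilizersIn_of_trees (fun i => ballTree (v i)) ?_ fun x => ?_
  · rintro i g ⟨p⟩
    refine congrArg (Quotient.mk (ballSetoid (v i))) (Prod.ext ?_ rfl)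
    exact add_assoc _ _ _
  · choose p hp using fun i => Quotient.exists_rep (s := ballSetoid (v i)) (x i)
    refine h𝔛 (fun i => (p i).1) (fun i => (p i).2) _ fun g hg i => ?_
    have hgi : g • x i = x i := congrFun hg i
    rw [← hp i] at hgi
    obtain ⟨h1, h2⟩ := Quotient.exact hgi
    change log (v i (ρ.linear g)) + (p i).1 = (p i).1 at h1
    have h0 : log (v i (ρ.linear g)) = 0 := by linarith
    refine ⟨?_, ?_⟩
    · rw [← exp_log (x := v i (ρ.linear g)) (by simp), h0, exp_zero]
    · change v i _ ≤ exp (log (v i (ρ.linear g)) + (p i).1) at h2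
      rwa [h1] at h2

end AffineAction

/-! ### Discrete valuations of the fraction field of a factorial domain -/

section FractionValuation

open WithZero

variable {A : Type*} [CommRing A] [IsDomain A]

open Classical in
/-- The valuation of a domain attached to a degree function. -/
noncomputable def degreeValuation (d : A → ℤ)
    (hmul : ∀ f g, f ≠ 0 → g ≠ 0 → d (f * g) = d f + d g)
    (hadd : ∀ f g, f ≠ 0 → g ≠ 0 → f + g ≠ 0 → d (f + g) ≤ max (d f) (d g)) :
    Valuation A (WithZero (Multiplicative ℤ)) where
  toFun f := if f = 0 then 0 else exp (d f)
  map_zero' := if_pos rfl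
  map_one' := by
    have := hmul 1 1 one_ne_zero one_ne_zero
    rw [mul_one] at this
    rw [if_neg one_ne_zero, exp_eq_one]
    linarith
  map_mul' f g := by
    by_cases hf : f = 0
    · simp [hf]
    by_cases hg : g = 0
    · simp [hg]
    rw [if_neg hf, if_neg hg, if_neg (mul_ne_zero hf hg), hmul f g hf hg, exp_add]
  map_add_le_max' f g := by
    by_cases hf : f = 0
    · simp [hf]
    by_cases hg : g = 0
    · simp [hg]
    by_cases hfg : f + g = 0
    · simp [hfg]
    rw [if_neg hf, if_neg hg, if_neg hfg, le_max_iff, exp_le_exp, exp_le_exp, ← le_max_iff]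
    exact hadd f g hf hg hfg

variable (K : Type*) [Field K] [Algebra A K] [IsFractionRing A K]

/-- The valuation of the fraction field of a domain attached to a degree function. -/
noncomputable def fractionValuation (d : A → ℤ)
    (hmul : ∀ f g, f ≠ 0 → g ≠ 0 → d (f * g) = d f + d g)
    (hadd : ∀ f g, f ≠ 0 → g ≠ 0 → f + g ≠ 0 → d (f + g) ≤ max (d f) (d g)) :
    Valuation K (WithZero (Multiplicative ℤ)) :=
  (degreeValuation d hmul hadd).extendToLocalization (S := nonZeroDivisors A) (by
    intro s hs h
    rw [SetLike.mem_coe, Valuation.mem_supp_iff] at h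
    have := nonZeroDivisors.ne_zero hs
    exact exp_ne_zero ((if_neg this).symm.trans h)) K

theorem fractionValuation_algebraMap {d : A → ℤ}
    (hmul : ∀ f g, f ≠ 0 → g ≠ 0 → d (f * g) = d f + d g)
    (hadd : ∀ f g, f ≠ 0 → g ≠ 0 → f + g ≠ 0 → d (f + g) ≤ max (d f) (d g)) {f : A} (hf : f ≠ 0) :
    fractionValuation K d hmul hadd (algebraMap A K f) = exp (d f) :=
  (Valuation.extendToLocalization_apply_map_apply _ _ _ _).trans (if_neg hf)

variable [UniqueFactorizationMonoid A]

/-- The valuation attached to a prime element of a factorial domain. -/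
noncomputable def primeValuation {p : A} (hp : Prime p) :
    Valuation K (WithZero (Multiplicative ℤ)) :=
  fractionValuation K (fun f => -(multiplicity p f : ℤ))
    (fun f g hf hg => by
      rw [multiplicity_mul hp (.of_prime_left hp (mul_ne_zero hf hg))]
      push_cast
      ring)
    (fun f g hf hg hfg => by
      have h := min_le_emultiplicity_add (p := p) (a := f) (b := g)
      rw [(FiniteMultiplicity.of_prime_left hp hf).emultiplicity_eq_multiplicity,
        (FiniteMultiplicity.of_prime_left hp hg).emultiplicity_eq_multiplicity,
        (FiniteMultiplicity.of_prime_left hp hfg).emultiplicity_eq_multiplicity] at h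
      simp only [min_le_iff, Nat.cast_le] at h
      omega)

variable {K}

theorem primeValuation_algebraMap {p : A} (hp : Prime p) {f : A} (hf : f ≠ 0) :
    primeValuation K hp (algebraMap A K f) = exp (-(multiplicity p f : ℤ)) :=
  fractionValuation_algebraMap K _ _ hf

theorem primeValuation_algebraMap_le_one {p : A} (hp : Prime p) (f : A) :
    primeValuation K hp (algebraMap A K f) ≤ 1 := by
  rcases eq_or_ne f 0 with rfl | hf
  · simp
  · rw [primeValuation_algebraMap hp hf, ← exp_zero, exp_le_exp]
    omega

theorem primeValuation_algebraMap_eq_one {p : A} (hp : Prime p) {f : A} (hpf : ¬ p ∣ f) :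
    primeValuation K hp (algebraMap A K f) = 1 := by
  have hf : f ≠ 0 := fun h => hpf (h ▸ dvd_zero p)
  rw [primeValuation_algebraMap hp hf, multiplicity_eq_zero.2 hpf]
  simp

theorem primeValuation_algebraMap_le_exp {p : A} (hp : Prime p) {f : A} (hpf : p ∣ f) :
    primeValuation K hp (algebraMap A K f) ≤ exp (-1) := by
  rcases eq_or_ne f 0 with rfl | hf
  · simp
  · rw [primeValuation_algebraMap hp hf, exp_le_exp]
    have := multiplicity_pos_of_dvd hpf
    omega

theorem primeValuation_eq_of_associated {p q : A} (hp : Prime p) (hq : Prime q)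
    (h : Associated p q) : primeValuation K hp = primeValuation K hq := by
  ext z
  obtain ⟨f, g, -, rfl⟩ := IsFractionRing.div_surjective (A := A) z
  have key : ∀ f : A, primeValuation K hp (algebraMap A K f) =
      primeValuation K hq (algebraMap A K f) := by
    intro f
    rcases eq_or_ne f 0 with rfl | hf
    · simp
    · rw [primeValuation_algebraMap hp hf, primeValuation_algebraMap hq hf,
        multiplicity_eq_of_associated_left h]
  rw [map_div₀, map_div₀, key, key]

/-- An element of the fraction field that is integral at all primes lies in the ring. -/
theorem mem_range_of_primeValuation_le_one {z : K}
    (hz : ∀ (p : A) (hp : Prime p), primeValuation K hp z ≤ 1) :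
    ∃ f : A, algebraMap A K f = z := by
  obtain ⟨f, g, hrel, rfl⟩ := IsFractionRing.exists_reduced_fraction (A := A) z
  have hg0 : algebraMap A K g ≠ 0 :=
    IsFractionRing.to_map_ne_zero_of_mem_nonZeroDivisors g.2
  by_cases hu : IsUnit (g : A)
  · obtain ⟨u, hu⟩ := hu
    refine ⟨f * (u⁻¹ : Aˣ), ?_⟩
    rw [IsFractionRing.mk'_eq_div, eq_div_iff hg0, ← map_mul, ← hu, Units.inv_mul_cancel_right]
  -- An irreducible factor of the reduced denominator would be a pole.
  · exfalso
    obtain ⟨p, hpi, hpg⟩ := WfDvdMonoid.exists_irreducible_factor hu (nonZeroDivisors.ne_zero g.2)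
    have hp := hpi.prime
    have hpf : ¬ p ∣ f := fun h => hpi.not_isUnit (hrel h hpg)
    have h := hz p hp
    rw [IsFractionRing.mk'_eq_div, map_div₀, primeValuation_algebraMap_eq_one hp hpf, one_div,
      inv_le_one₀ (by simp [zero_lt_iff])] at h
    have h' := h.trans (primeValuation_algebraMap_le_exp hp hpg)
    rw [← exp_zero, exp_le_exp] at h'
    omega

theorem exists_unit_of_primeValuation_eq_one {z : K}
    (hz : ∀ (p : A) (hp : Prime p), primeValuation K hp z = 1) (hz0 : z ≠ 0) :
    ∃ u : Aˣ, algebraMap A K u = z := by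
  obtain ⟨f, hf⟩ := mem_range_of_primeValuation_le_one fun p hp => (hz p hp).le
  obtain ⟨g, hg⟩ := mem_range_of_primeValuation_le_one (z := z⁻¹)
    fun p hp => (by rw [map_inv₀, hz p hp, inv_one] : primeValuation K hp z⁻¹ = 1).le
  have hfg : f * g = 1 := by
    apply IsFractionRing.injective A K
    rw [map_mul, hf, hg, mul_inv_cancel₀ hz0, map_one]
  exact ⟨Units.mkOfMulEqOne f g hfg, hf⟩

/-- Bounded denominators: an element integral away from `D` whose poles along the divisors of `D`
are bounded is a fraction with a fixed power of `D` as denominator. -/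
theorem exists_algebraMap_eq_mul_pow {D : A} {n : ℕ} {z : K}
    (h1 : ∀ (p : A) (hp : Prime p), ¬ p ∣ D → primeValuation K hp z ≤ 1)
    (h2 : ∀ (p : A) (hp : Prime p), p ∣ D → primeValuation K hp z ≤ exp (n : ℤ)) :
    ∃ f : A, algebraMap A K f = z * algebraMap A K D ^ n := by
  refine mem_range_of_primeValuation_le_one fun p hp => ?_
  rw [map_mul, map_pow]
  by_cases h : p ∣ D
  · calc _ ≤ exp (n : ℤ) * exp (-1) ^ n :=
        mul_le_mul' (h2 p hp h) (pow_le_pow_left' (primeValuation_algebraMap_le_exp hp h) n)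
      _ = 1 := by
        rw [← exp_nsmul, ← exp_add, ← exp_zero]
        congr 1
        simp
  · exact mul_le_one' (h1 p hp h) (pow_le_one' (primeValuation_algebraMap_le_one hp D) n)

end FractionValuation

/-! ### Valuations from ℤ[X] -/

section IntPolynomial

open WithZero Polynomial

variable (K : Type u) [Field K] [Algebra ℤ[X] K] [IsFractionRing ℤ[X] K]

/-- The valuation of `ℚ(X)` given by the degree. -/
noncomputable def natDegreeValuation : Valuation K (WithZero (Multiplicative ℤ)) :=
  fractionValuation (A := ℤ[X]) K (fun f => (f.natDegree : ℤ))
    (fun f g hf hg => by rw [natDegree_mul hf hg]; push_cast; rfl)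
    (fun f g _ _ _ => by exact_mod_cast natDegree_add_le f g)

variable {K}

theorem natDegreeValuation_algebraMap {f : ℤ[X]} (hf : f ≠ 0) :
    natDegreeValuation K (algebraMap ℤ[X] K f) = exp (f.natDegree : ℤ) :=
  fractionValuation_algebraMap K _ _ hf

theorem eq_one_or_neg_one_of_primeValuation_eq_one {z : K}
    (hz : ∀ (p : ℤ[X]) (hp : Prime p), primeValuation K hp z = 1) (hz0 : z ≠ 0) :
    z = 1 ∨ z = -1 := by
  obtain ⟨u, rfl⟩ := exists_unit_of_primeValuation_eq_one hz hz0
  obtain ⟨r, hr, hru⟩ := Polynomial.isUnit_iff.1 u.isUnit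
  rw [← hru]
  rcases Int.isUnit_iff.1 hr with rfl | rfl <;> simp

end IntPolynomial

/-! ### The second and third levels of the hierarchy -/

open WithZero Polynomial UniqueFactorizationMonoid in
/-- A group of affine maps of `ℚ(X)` that are integral away from `D` acts on a product of trees with
free abelian stabilizers. -/
theorem AffineAction.HClass_two_of_integral {G K : Type} [Group G] [Field K] [Algebra ℤ[X] K]
    [IsFractionRing ℤ[X] K] (ρ : AffineAction G K)
    (hinj : ∀ g, ρ.linear g = 1 → ρ.translation g = 0 → g = 1)
    (hneg : ∀ g, (ρ.linear g : K) ≠ -1) {D : ℤ[X]} (hD0 : D ≠ 0)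
    (hD : ∀ (p : ℤ[X]) (hp : Prime p), ¬ p ∣ D → ∀ g, g ∈ ρ.integral (primeValuation K hp)) :
    HClass FiniteGroups 2 G := by
  have h2 : (2 : Ordinal.{0}) = 1 + 1 := one_add_one_eq_two.symm
  rw [h2, HClass_add_one]
  have hfin : Finite {p // p ∈ factors D} := (Multiset.finite_toSet (factors D)).to_subtype
  -- The index `none` is the place at infinity; it serves only to bound degrees.
  let v : Option {p // p ∈ factors D} → Valuation K (WithZero (Multiplicative ℤ)) := fun i =>
    i.elim (natDegreeValuation K) fun p => primeValuation K (prime_of_factor p.1 p.2)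
  have hv : ∀ (p : ℤ[X]) (hp : Prime p), p ∣ D → ∃ i, v i = primeValuation K hp := by
    intro p hp hpD
    obtain ⟨q, hq, hpq⟩ := exists_mem_factors_of_dvd hD0 hp.irreducible hpD
    exact ⟨some ⟨q, hq⟩, primeValuation_eq_of_associated (prime_of_factor q hq) hp hpq.symm⟩
  refine ρ.actsWithStabilizersIn v fun n c H hH => ?_
  have hlin : ∀ g ∈ H, ρ.linear g = 1 := by
    intro g hg
    refine Units.ext ((eq_one_or_neg_one_of_primeValuation_eq_one (fun p hp => ?_)
      (ρ.linear g).ne_zero).resolve_right (hneg g))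
    by_cases hpD : p ∣ D
    · obtain ⟨i, hi⟩ := hv p hp hpD
      exact hi ▸ (hH g hg i).1
    · exact (hD p hp hpD g).1
  -- With trivial linear part the centre cancels, leaving a bound on the translation itself.
  have htrans : ∀ g ∈ H, ∀ i, v i (ρ.translation g) ≤ exp (n i) := by
    intro g hg i
    simpa [hlin g hg] using (hH g hg i).2
  obtain ⟨M, hM⟩ : ∃ M : ℕ, ∀ i, n i ≤ M := by
    obtain ⟨B, hB⟩ := (Set.finite_range n).bddAbove
    exact ⟨B.toNat, fun i => (hB ⟨i, rfl⟩).trans (Int.self_le_toNat B)⟩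
  have hpoly : ∀ g : H, ∃ f : ℤ[X],
      algebraMap ℤ[X] K f = ρ.translation g * algebraMap ℤ[X] K D ^ M := by
    intro g
    refine exists_algebraMap_eq_mul_pow (fun p hp hpD => (hD p hp hpD g).2) fun p hp hpD => ?_
    obtain ⟨i, hi⟩ := hv p hp hpD
    exact hi ▸ (htrans g g.2 i).trans (exp_le_exp.2 (hM i))
  choose f hf using hpoly
  have hDK : algebraMap ℤ[X] K D ≠ 0 :=
    (map_ne_zero_iff _ (IsFractionRing.injective ℤ[X] K)).2 hD0
  have hadd : ∀ g h, f (g * h) = f g + f h := by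
    intro g h
    apply IsFractionRing.injective ℤ[X] K
    rw [map_add, hf, hf, hf, Subgroup.coe_mul, ρ.translation_mul, hlin g g.2]
    simp [add_mul]
  have hdeg : ∀ g, (f g).natDegree < M + M * D.natDegree + 1 := by
    intro g
    rcases eq_or_ne (f g) 0 with h0 | h0
    · simp [h0]
    have h1 := natDegreeValuation_algebraMap (K := K) h0
    rw [hf, map_mul, map_pow, natDegreeValuation_algebraMap hD0, ← exp_nsmul] at h1
    have h2 := mul_le_mul_left ((htrans g g.2 none).trans (exp_le_exp.2 (hM none)))
      (exp (M • (D.natDegree : ℤ)))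
    rw [← exp_add] at h2
    have h3 := exp_le_exp.1 (h1.symm.trans_le h2)
    rw [nsmul_eq_mul] at h3
    have h4 : (f g).natDegree ≤ M + M * D.natDegree := by exact_mod_cast h3
    omega
  -- The elements of `H` are translations, so numerators over the common denominator D^M add; the
  -- coefficients up to degree M + M·deg D determine them.
  let φ : H →* Multiplicative (Fin (M + M * D.natDegree + 1) → ℤ) :=
    MonoidHom.mk' (fun g => Multiplicative.ofAdd fun j => (f g).coeff j) fun g h => by
      rw [hadd, ← ofAdd_add]
      congr 1
  have hφ : Function.Injective φ := by
    refine (injective_iff_map_eq_one φ).2 fun g hg => ?_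
    have hfg : f g = 0 := by
      ext j
      by_cases hj : j < M + M * D.natDegree + 1
      · exact congrFun (congrArg Multiplicative.toAdd hg) ⟨j, hj⟩
      · rw [coeff_zero]
        exact coeff_eq_zero_of_natDegree_lt (by have := hdeg g; omega)
    have h0 := hf g
    rw [hfg, map_zero] at h0
    exact Subtype.ext (hinj g (hlin g g.2)
      ((mul_eq_zero.1 h0.symm).resolve_right (pow_ne_zero M hDK)))
  have key := HClass_natCast_closedUnderEmbeddings 1 _ H φ hφ
  rw [Nat.cast_one] at key
  exact key (HClass_one_freeAbelian _)

open WithZero Polynomial in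
/-- A group of affine maps of `ℚ(X)` is an increasing union of subgroups integral away from finitely
many primes. -/
theorem AffineAction.HClass_three {G K : Type} [Group G] [Field K] [Algebra ℤ[X] K]
    [IsFractionRing ℤ[X] K] (ρ : AffineAction G K)
    (hinj : ∀ g, ρ.linear g = 1 → ρ.translation g = 0 → g = 1)
    (hneg : ∀ g, (ρ.linear g : K) ≠ -1) : HClass FiniteGroups 3 G := by
  have h3 : (3 : Ordinal.{0}) = 2 + 1 := two_add_one_eq_three.symm
  rw [h3, HClass_add_one]
  have hcount : Countable ℤ[X] :=
    Cardinal.mk_le_aleph0_iff.1 (cardinalMk_le_max.trans (by simp))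
  obtain ⟨e, he⟩ := exists_surjective_nat (nonZeroDivisors ℤ[X])
  let D : ℕ → ℤ[X] := fun n => ∏ i ∈ Finset.range n, (e i : ℤ[X])
  have hD0 : ∀ n, D n ≠ 0 := fun n =>
    Finset.prod_ne_zero_iff.2 fun i _ => nonZeroDivisors.ne_zero (e i).2
  have hDdvd : ∀ m n, m ≤ n → D m ∣ D n := fun m n h =>
    Finset.prod_dvd_prod_of_subset _ _ _ (Finset.range_mono h)
  let N : ℕ → Subgroup G := fun n =>
    ⨅ (p : ℤ[X]) (hp : Prime p) (_ : ¬ p ∣ D n), ρ.integral (primeValuation K hp)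
  have hN : ∀ n g, g ∈ N n ↔ ∀ (p : ℤ[X]) (hp : Prime p), ¬ p ∣ D n →
      g ∈ ρ.integral (primeValuation K hp) := fun n g => by
    simp only [N, Subgroup.mem_iInf]
  refine actsWithStabilizersIn_of_directedUnion N ?_ ?_ ?_ fun n => ?_
  · intro m n hmn g hg
    rw [hN] at hg ⊢
    exact fun p hp h => hg p hp fun h' => h (h'.trans (hDdvd m n hmn))
  · intro g
    obtain ⟨a, b, hb, hab⟩ := IsFractionRing.div_surjective (A := ℤ[X]) (ρ.linear g : K)
    obtain ⟨c, d, hd, hcd⟩ := IsFractionRing.div_surjective (A := ℤ[X]) (ρ.translation g)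
    have ha : a ≠ 0 := by
      rintro rfl
      rw [map_zero, zero_div] at hab
      exact (ρ.linear g).ne_zero hab.symm
    -- The numerator `a` is included as well, because the linear part has to be a unit, not merely
    -- integral, away from D.
    obtain ⟨i, hi⟩ := he ⟨a * (b * d), mul_mem (mem_nonZeroDivisors_of_ne_zero ha) (mul_mem hb hd)⟩
    refine ⟨i + 1, (hN _ _).2 fun p hp hpD => ?_⟩
    have hdvd : a * (b * d) ∣ D (i + 1) := by
      have := Finset.dvd_prod_of_mem (fun i => (e i : ℤ[X])) (Finset.self_mem_range_succ i)
      rwa [hi] at this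
    have hpa : ¬ p ∣ a := fun h => hpD ((h.mul_right _).trans hdvd)
    have hpb : ¬ p ∣ b := fun h => hpD (((h.mul_right _).mul_left _).trans hdvd)
    have hpd : ¬ p ∣ d := fun h => hpD (((h.mul_left _).mul_left _).trans hdvd)
    constructor
    · rw [← hab, map_div₀, primeValuation_algebraMap_eq_one hp hpa,
        primeValuation_algebraMap_eq_one hp hpb, div_one]
    · rw [← hcd, map_div₀, primeValuation_algebraMap_eq_one hp hpd, div_one]
      exact primeValuation_algebraMap_le_one hp c
  · exact_mod_cast HClass_natCast_closedUnderEmbeddings 2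
  · refine (ρ.restrict (N n)).HClass_two_of_integral (fun g h1 h2 => ?_) (fun g => hneg g) (hD0 n)
      fun p hp hpD g => ?_
    · exact Subtype.ext (hinj g h1 h2)
    · exact (hN n g).1 g.2 p hp hpD

/-! ### Application to ℚ(t) -/

open Polynomial in
/-- The field generated by a transcendental number is the field of fractions of `ℤ[X]`. -/
theorem isFractionRing_adjoin_transcendental {t : ℝ} (ht : Transcendental ℚ t) :
    @IsFractionRing ℤ[X] _ (IntermediateField.adjoin ℚ {t}) _
      (aeval (IntermediateField.AdjoinSimple.gen ℚ t) :
        ℤ[X] →ₐ[ℤ] IntermediateField.adjoin ℚ {t}).toRingHom.toAlgebra := by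
  let _ : Algebra ℤ[X] (IntermediateField.adjoin ℚ {t}) :=
    (aeval (IntermediateField.AdjoinSimple.gen ℚ t) :
        ℤ[X] →ₐ[ℤ] IntermediateField.adjoin ℚ {t}).toRingHom.toAlgebra
  have hmap : ∀ f : ℤ[X], ((algebraMap ℤ[X] (IntermediateField.adjoin ℚ {t}) f :
      IntermediateField.adjoin ℚ {t}) : ℝ) = aeval t (f.map (algebraMap ℤ ℚ)) := by
    intro f
    rw [aeval_map_algebraMap]
    change algebraMap (IntermediateField.adjoin ℚ {t}) ℝ (aeval _ f) = _
    rw [← aeval_algebraMap_apply, IntermediateField.AdjoinSimple.algebraMap_gen]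
  have hinj : Function.Injective (algebraMap ℤ[X] (IntermediateField.adjoin ℚ {t})) := by
    refine (injective_iff_map_eq_zero _).2 fun f hf => ?_
    have h := hmap f
    rw [hf, ZeroMemClass.coe_zero] at h
    have h' := transcendental_iff.1 ht _ h.symm
    exact (Polynomial.map_eq_zero_iff (algebraMap ℤ ℚ).injective_int).1 h'
  have : FaithfulSMul ℤ[X] (IntermediateField.adjoin ℚ {t}) :=
    (faithfulSMul_iff_algebraMap_injective _ _).2 hinj
  refine IsFractionRing.of_field _ _ fun z => ?_
  obtain ⟨r, s, hrs⟩ := IntermediateField.mem_adjoin_simple_iff ℚ (z : ℝ) |>.1 z.2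
  obtain ⟨a, ha, har⟩ := IsLocalization.integerNormalization_spec (nonZeroDivisors ℤ) r
  obtain ⟨b, hb, hbs⟩ := IsLocalization.integerNormalization_spec (nonZeroDivisors ℤ) s
  have ha0 : (a : ℝ) ≠ 0 := Int.cast_ne_zero.2 (nonZeroDivisors.ne_zero ha)
  have hb0 : (b : ℝ) ≠ 0 := Int.cast_ne_zero.2 (nonZeroDivisors.ne_zero hb)
  -- The normalizations are a·r and b·s; multiplying crosswise by b and a restores the quotient r/s.
  refine ⟨C b * IsLocalization.integerNormalization (nonZeroDivisors ℤ) r,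
    C a * IsLocalization.integerNormalization (nonZeroDivisors ℤ) s, Subtype.ext ?_⟩
  change (z : ℝ) = ((algebraMap ℤ[X] (IntermediateField.adjoin ℚ {t}) _ :
    IntermediateField.adjoin ℚ {t}) : ℝ) / ((algebraMap ℤ[X] (IntermediateField.adjoin ℚ {t}) _ :
    IntermediateField.adjoin ℚ {t}) : ℝ)
  rw [hmap, hmap, Polynomial.map_mul, Polynomial.map_mul, har, hbs, hrs]
  simp only [map_mul, zsmul_eq_mul, eq_intCast, Polynomial.map_intCast, map_intCast]
  rw [← mul_assoc, ← mul_assoc, mul_comm (a : ℝ) b, mul_div_mul_left _ _ (mul_ne_zero hb0 ha0)]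

/-- The defining action of the group of affine maps. -/
noncomputable def affineGroupAction (t : ℝ) :
    AffineAction (affineGroup t) (IntermediateField.adjoin ℚ {t}) where
  linear :=
    { toFun g := Units.mk0 (g.1 0 0) fun h => by
        have := g.2.1
        rw [h] at this
        simp at this
      map_one' := by ext; simp
      map_mul' g h := by
        ext
        simp [Matrix.mul_apply, Fin.sum_univ_two, h.2.2.1] }
  translation g := g.1 0 1
  translation_mul g h := by
    simp [Matrix.mul_apply, Fin.sum_univ_two, h.2.2.2, add_comm]

theorem corollary2p8 (t : ℝ) (ht : Transcendental ℚ t) :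
    HClass FiniteGroups 3 (affineGroup t) := by
  let _ := (Polynomial.aeval (IntermediateField.AdjoinSimple.gen ℚ t) :
    Polynomial ℤ →ₐ[ℤ] IntermediateField.adjoin ℚ {t}).toRingHom.toAlgebra
  have := isFractionRing_adjoin_transcendental ht
  refine (affineGroupAction t).HClass_three (fun g h1 h2 => ?_) fun g h => ?_
  · have h1' : g.1 0 0 = 1 := congrArg Units.val h1
    have h2' : g.1 0 1 = 0 := h2
    refine Subtype.ext (Units.ext ?_)
    ext i j
    fin_cases i <;> fin_cases j <;> simp [h1', h2', g.2.2.1, g.2.2.2]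
  -- Positivity of the upper left entry excludes −1, the only nontrivial unit of ℤ[X].
  · have hpos := g.2.1
    have h' : g.1 0 0 = -1 := h
    rw [h'] at hpos
    simp at hpos
    linarith
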